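/- Let $A$ and $B$ be real $N\times N$ matrices, with $A$ symmetric and non-negative definite. For $t\in\mathbb{R}$ put $$E(t)=e^{-tB},\qquad C(t)=\int_0^t E(s)\,A\,E(s)^T\,ds .$$ Assume that $C(t)$ is positive definite for every $t>0$, and that every complex eigenvalue of $B$ is purely imaginary, i.e. $\sigma(B)\subseteq i\mathbb{R}$ (the eigenvalue $0$ is allowed). Then there exists a constant $k_0>0$ (depending only on $A$ and $B$) such that, for every $t\ge 1$, every $0<\mu\le 1$ and every $\xi\in\mathbb{R}^N$, $$\left\langle E(-t)C(t)E(-t)^T\xi,\xi\right\rangle\ \ge\ \frac{k_0}{\mu}\left\langle E(-\mu t)C(\mu t)E(-\mu t)^T\xi,\xi\right\rangle$$ and $$\left\langle E(t)^TC^{-1}(t)E(t)\xi,\xi\right\rangle\ \le\ \frac{\mu}{k_0}\left\langle E(\mu t)^TC^{-1}(\mu t)E(\mu t)\xi,\xi\right\rangle ,$$ where $C^{-1}(t)$ denotes the inverse matrix of $C(t)$ and $\langle\cdot,\cdot\rangle$ the Euclidean inner product. -/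

import Mathlib

open scoped Matrix

noncomputable section

namespace OrnsteinUhlenbeck

/-- The matrix exponential `E(t) = exp(-tB)` of a real square matrix `B`. -/
def E {N : ℕ} (B : Matrix (Fin N) (Fin N) ℝ) (t : ℝ) : Matrix (Fin N) (Fin N) ℝ :=
  NormedSpace.exp (-t • B)

/-- The Kalman matrix `C(t) = ∫₀ᵗ E(s) A E(s)ᵀ ds`, integrated entry by entry. -/
def C {N : ℕ} (A B : Matrix (Fin N) (Fin N) ℝ) (t : ℝ) : Matrix (Fin N) (Fin N) ℝ :=
  Matrix.of fun i j => ∫ s in (0 : ℝ)..t, (E B s * A * (E B s)ᵀ) i j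

/-- The quadratic form `⟨M ξ, ξ⟩` of a real square matrix `M`. -/
def quadForm {N : ℕ} (M : Matrix (Fin N) (Fin N) ℝ) (ξ : Fin N → ℝ) : ℝ :=
  (M *ᵥ ξ) ⬝ᵥ ξ

end OrnsteinUhlenbeck

end

open scoped Matrix

/-! Factor `A = Sᵀ * S` and put g(u) = |S E(-u)ᵀ ξ|². The form of E(-t)C(t)E(-t)ᵀ at ξ is the
integral of g over [0, t], so the first inequality says that an initial segment of relative length μ
carries at most κμ of the total. This follows from sup g ≤ (K/t) ∫ g on [0, t], with K depending on
N alone (`mul_le_integral_of_recurrence`). That bound is of Turán type. By Cayley–Hamilton, E(h) is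
annihilated by the monic polynomial with roots exp(-hz), z running over the eigenvalues of B. These
have modulus one, so the coefficients are bounded uniformly in h, and g(u) is controlled by g at N
earlier points of step h, for every h (`quadForm_E_le_sum`). Averaging over h turns this into an
integral bound. The second inequality is the first one inverted (`quadForm_inv_le`). -/

open Polynomial in
theorem exists_commute_exp_sub_algebraMap_exp {𝔸 : Type*} [NormedRing 𝔸] [NormedAlgebra ℂ 𝔸]
    [CompleteSpace 𝔸] (a : 𝔸) (z : ℂ) :
    ∃ b : 𝔸, Commute b a ∧
      NormedSpace.exp a - algebraMap ℂ 𝔸 (Complex.exp z) = (a - algebraMap ℂ 𝔸 z) * b := by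
  let +nondep : NormedAlgebra ℚ 𝔸 := .restrictScalars ℚ ℂ 𝔸
  set c := a - algebraMap ℂ 𝔸 z with hc
  have hexp : NormedSpace.exp a = NormedSpace.exp c * algebraMap ℂ 𝔸 (NormedSpace.exp z) := by
    rw [NormedSpace.algebraMap_exp_comm z,
      ← NormedSpace.exp_add_of_commute (Algebra.commutes z c).symm, sub_add_cancel]
  have hs : Summable fun n : ℕ => ((n + 1).factorial⁻¹ : ℂ) • c ^ n := by
    refine .of_norm_bounded_eventually (Real.summable_pow_div_factorial ‖c‖) ?_
    filter_upwards [Filter.eventually_cofinite_ne 0] with n hn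
    rw [norm_smul, mul_comm, norm_inv, RCLike.norm_natCast, ← div_eq_mul_inv]
    gcongr
    · exact norm_pow_le' _ (pos_iff_ne_zero.mpr hn)
    · exact n.le_succ
  -- This is (exp c - 1) / c as a power series, so no invertibility of `c` is needed.
  set b := ∑' n : ℕ, ((n + 1).factorial⁻¹ : ℂ) • c ^ n with hb
  have hcb : (∑' n : ℕ, ((n + 1).factorial⁻¹ : ℂ) • c ^ (n + 1)) = c * b := by
    simpa only [mul_smul_comm, pow_succ'] using hs.tsum_mul_left c
  have hcomm : Commute b a := by
    have hca : Commute a c := (Commute.refl a).sub_right (Algebra.commutes z a).symm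
    refine (Commute.tsum_right a fun n => ?_).symm
    exact (hca.pow_right n).smul_right _
  have h1 : NormedSpace.exp c = 1 + c * b := by
    rw [NormedSpace.exp_eq_tsum ℂ]
    convert! (NormedSpace.expSeries_summable' (𝕂 := ℂ) c).tsum_eq_zero_add
    · simp only [Nat.factorial_zero, Nat.cast_one, inv_one, pow_zero, one_smul]
    · exact hcb.symm
  refine ⟨b * algebraMap ℂ 𝔸 (NormedSpace.exp z), ?_, ?_⟩
  · exact hcomm.mul_left (Algebra.commutes _ a)
  · rw [hexp, h1, Complex.exp_eq_exp_ℂ, add_mul, one_mul, add_sub_cancel_left, mul_assoc]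

-- Divisibility factor by factor keeps multiplicities, so `a` need not be diagonalizable: a
-- polynomial split over ℂ that kills `a` yields one that kills its exponential.
open Polynomial in
theorem exists_aeval_exp_smul_prod_eq {𝔸 : Type*} [NormedRing 𝔸] [NormedAlgebra ℂ 𝔸]
    [CompleteSpace 𝔸] (a : 𝔸) (h : ℂ) (s : Multiset ℂ) :
    ∃ b : 𝔸, aeval (NormedSpace.exp (h • a)) (s.map fun z => X - C (Complex.exp (h * z))).prod =
      aeval a (s.map fun z => X - C z).prod * b := by
  suffices ∃ b : 𝔸, Commute b a ∧
      aeval (NormedSpace.exp (h • a)) (s.map fun z => X - C (Complex.exp (h * z))).prod =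
        aeval a (s.map fun z => X - C z).prod * b from this.imp fun _ => And.right
  induction s using Multiset.induction_on with
  | empty => exact ⟨1, Commute.one_left a, by simp⟩
  | cons z s ih =>
    obtain ⟨b, hba, hb⟩ := ih
    obtain ⟨d, hda, hd⟩ := exists_commute_exp_sub_algebraMap_exp (h • a) (h * z)
    -- `d` is only known to commute with `h • a`; cancelling `h` requires `h ≠ 0`. For `h = 0` the
    -- new factor on the left vanishes.
    by_cases hh : h = 0
    · refine ⟨0, Commute.zero_left a, ?_⟩
      simp [hh]
    have hda' : Commute d a := by
      have := hda.smul_right h⁻¹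
      rwa [inv_smul_smul₀ hh] at this
    refine ⟨(h • d) * b, (hda'.smul_left h).mul_left hba, ?_⟩
    have hP : Commute d (aeval a (s.map fun z => X - C z).prod) := by
      rw [aeval_eq_sum_range]
      exact Commute.sum_right _ _ _ fun k _ => (hda'.pow_right k).smul_right _
    have hz : h • a - algebraMap ℂ 𝔸 (h * z) = h • (a - algebraMap ℂ 𝔸 z) := by
      rw [smul_sub, map_mul, Algebra.smul_def h (algebraMap ℂ 𝔸 z)]
    rw [Multiset.map_cons, Multiset.prod_cons, Multiset.map_cons, Multiset.prod_cons, map_mul,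
      map_mul, hb, map_sub, map_sub, aeval_X, aeval_X, aeval_C, aeval_C, hd, hz]
    simp only [smul_mul_assoc, mul_smul_comm, mul_assoc]
    rw [← mul_assoc d, hP.eq, mul_assoc]

/-- A matrix exponential whose generator has purely imaginary spectrum satisfies a monic
polynomial equation with uniformly bounded coefficients. -/
theorem exists_bounded_recurrence {N : ℕ} (M : Matrix (Fin N) (Fin N) ℂ)
    (hM : ∀ z ∈ spectrum ℂ M, z.re = 0) (h : ℝ) :
    ∃ q : ℕ → ℂ, (∀ k, ‖q k‖ ≤ 2 ^ N) ∧
      NormedSpace.exp ((h : ℂ) • M) ^ N =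
        ∑ k ∈ Finset.range N, q k • NormedSpace.exp ((h : ℂ) • M) ^ k := by
  let _ : NormedRing (Matrix (Fin N) (Fin N) ℂ) := Matrix.linftyOpNormedRing
  let _ : NormedAlgebra ℂ (Matrix (Fin N) (Fin N) ℂ) := Matrix.linftyOpNormedAlgebra
  set Q : Polynomial ℂ := (M.charpoly.roots.map fun z =>
    Polynomial.X - Polynomial.C (Complex.exp (h * z))).prod with hQ
  have hsplit := IsAlgClosed.splits M.charpoly
  have hmonic : Q.Monic := Polynomial.monic_multiset_prod_of_monic _ _
    fun z _ => Polynomial.monic_X_sub_C _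
  have hQ' : Q = ((M.charpoly.roots.map fun z => Complex.exp (h * z)).map fun w =>
    Polynomial.X - Polynomial.C w).prod := by rw [hQ, Multiset.map_map]; rfl
  have hdeg : Q.natDegree = N := by
    rw [hQ', Polynomial.natDegree_multiset_prod_X_sub_C_eq_card, Multiset.card_map,
      ← hsplit.natDegree_eq_card_roots, Matrix.charpoly_natDegree_eq_dim, Fintype.card_fin]
  have hzero : Polynomial.aeval (NormedSpace.exp ((h : ℂ) • M)) Q = 0 := by
    obtain ⟨b, hb⟩ := exists_aeval_exp_smul_prod_eq M h M.charpoly.roots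
    rw [← hsplit.eq_prod_roots_of_monic M.charpoly_monic] at hb
    exact hb.trans ((congrArg (· * b) (Matrix.aeval_self_charpoly M)).trans (zero_mul b))
  have hcoeff : ∀ k, ‖Q.coeff k‖ ≤ 2 ^ N := by
    intro k
    -- All roots lie on the unit circle, so the coefficients are at most binomial coefficients.
    have := Polynomial.coeff_le_of_roots_le (p := Q) (f := RingHom.id ℂ) (B := 1) k hmonic
      (IsAlgClosed.splits _) (by
        intro w hw
        rw [Polynomial.map_id, hQ', Polynomial.roots_multiset_prod_X_sub_C,
          Multiset.mem_map] at hw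
        obtain ⟨z, hz, rfl⟩ := hw
        have hre := hM z (Matrix.mem_spectrum_iff_isRoot_charpoly.mpr
          (Polynomial.isRoot_of_mem_roots hz))
        rw [Complex.norm_exp]
        simp [hre])
    rw [Polynomial.map_id, one_pow, one_mul, hdeg] at this
    refine this.trans ?_
    exact_mod_cast Nat.choose_le_two_pow N k
  refine ⟨fun k => -Q.coeff k, fun k => by simpa using hcoeff k, ?_⟩
  rw [Polynomial.aeval_eq_sum_range, hdeg, Finset.sum_range_succ] at hzero
  have h1 : Q.coeff N = 1 := by rw [← hdeg]; exact hmonic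
  rw [h1, one_smul] at hzero
  rw [eq_neg_of_add_eq_zero_right hzero, ← Finset.sum_neg_distrib]
  simp

/-! ### Averaging a recurrence over its step -/

theorem mul_le_integral_of_recurrence_right {g : ℝ → ℝ} (hg : Continuous g) (hg0 : ∀ u, 0 ≤ g u)
    {N : ℕ} {K : ℝ} (hK : 0 ≤ K)
    (hrec : ∀ u h : ℝ, g u ≤ K * ∑ k ∈ Finset.range N, g (u - (k + 1) * h))
    {t u : ℝ} (ht : 0 < t) (hu : t / 2 ≤ u) (hut : u ≤ t) :
    t * g u ≤ 2 * (N + 1) * (K * N) * ∫ s in (0 : ℝ)..t, g s := by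
  -- Then N δ ≤ t/2, so for h ≤ δ the points u - (k+1)h stay in [0, t].
  set δ : ℝ := t / (2 * (N + 1)) with hδ
  have hN : (0 : ℝ) < 2 * (N + 1) := by positivity
  have hδ0 : 0 < δ := by positivity
  have hint : ∀ a b, IntervalIntegrable g MeasureTheory.volume a b := hg.intervalIntegrable
  have h1 : δ * g u ≤ K * ∑ k ∈ Finset.range N, ∫ h in (0 : ℝ)..δ, g (u - (k + 1) * h) := by
    rw [← intervalIntegral.integral_finsetSum fun (k : ℕ) _ =>
      (by fun_prop : Continuous fun h : ℝ => g (u - (k + 1) * h)).intervalIntegrable _ _,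
      ← intervalIntegral.integral_const_mul]
    have : δ * g u = ∫ _ in (0 : ℝ)..δ, g u := by simp
    rw [this]
    exact intervalIntegral.integral_mono_on hδ0.le (by simp)
      ((by fun_prop : Continuous fun h : ℝ =>
        K * ∑ k ∈ Finset.range N, g (u - (k + 1) * h)).intervalIntegrable _ _)
      fun h _ => hrec u h
  have h2 : ∀ k ∈ Finset.range N,
      ∫ h in (0 : ℝ)..δ, g (u - (k + 1) * h) ≤ ∫ s in (0 : ℝ)..t, g s := by
    intro k hk
    have hk1 : (0 : ℝ) < k + 1 := by positivity
    have hkN : (k : ℝ) + 1 ≤ N := by exact_mod_cast Finset.mem_range.mp hk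
    have hkδ : (k + 1) * δ ≤ t / 2 := by
      rw [hδ, mul_div_assoc', div_le_div_iff₀ hN two_pos]
      nlinarith
    rw [intervalIntegral.integral_comp_sub_mul g hk1.ne' u, smul_eq_mul, mul_zero, sub_zero]
    have hsub : ∫ s in (u - (k + 1) * δ)..u, g s ≤ ∫ s in (0 : ℝ)..t, g s :=
      intervalIntegral.integral_mono_interval (by linarith) (by nlinarith) hut
        (Filter.Eventually.of_forall hg0) (hint _ _)
    have hnn : 0 ≤ ∫ s in (u - (k + 1) * δ)..u, g s :=
      intervalIntegral.integral_nonneg (by nlinarith) fun s _ => hg0 s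
    have hinv : ((k : ℝ) + 1)⁻¹ ≤ 1 := inv_le_one_of_one_le₀ (by linarith [k.cast_nonneg (α := ℝ)])
    nlinarith
  have h3 := Finset.sum_le_sum h2
  rw [Finset.sum_const, Finset.card_range, nsmul_eq_mul] at h3
  have h4 : δ * g u ≤ K * (N * ∫ s in (0 : ℝ)..t, g s) :=
    h1.trans (mul_le_mul_of_nonneg_left h3 hK)
  have h5 : t = 2 * (N + 1) * δ := by rw [hδ]; field_simp
  calc t * g u = 2 * (N + 1) * (δ * g u) := by rw [← mul_assoc, ← h5]
    _ ≤ 2 * (N + 1) * (K * (N * ∫ s in (0 : ℝ)..t, g s)) := by gcongr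
    _ = _ := by ring

/-- A Turán-type inequality: a nonnegative function controlled by its values along every
arithmetic progression is bounded on `[0, t]` by its mean value. -/
theorem mul_le_integral_of_recurrence {g : ℝ → ℝ} (hg : Continuous g) (hg0 : ∀ u, 0 ≤ g u)
    {N : ℕ} {K : ℝ} (hK : 0 ≤ K)
    (hrec : ∀ u h : ℝ, g u ≤ K * ∑ k ∈ Finset.range N, g (u - (k + 1) * h))
    {t u : ℝ} (ht : 0 < t) (hu : 0 ≤ u) (hut : u ≤ t) :
    t * g u ≤ 2 * (N + 1) * (K * N) * ∫ s in (0 : ℝ)..t, g s := by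
  rcases le_total (t / 2) u with h | h
  · exact mul_le_integral_of_recurrence_right hg hg0 hK hrec ht h hut
  -- The left half reduces to the right half by s ↦ t - s; the recurrence survives because h may be
  -- negative.
  · have := mul_le_integral_of_recurrence_right (g := fun s => g (t - s)) (by fun_prop)
      (fun s => hg0 _) hK (N := N) (fun v h => ?_) ht (u := t - u) (by linarith) (by linarith)
    · simpa using this
    · refine (hrec (t - v) (-h)).trans_eq ?_
      congr 2 with k
      congr 1
      ring
-- The group E(t) and the quadratic form of C(t)
namespace OrnsteinUhlenbeck

variable {N : ℕ}

theorem E_zero (B : Matrix (Fin N) (Fin N) ℝ) : E B 0 = 1 := by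
  simp [E]

theorem E_add (B : Matrix (Fin N) (Fin N) ℝ) (s t : ℝ) : E B (s + t) = E B s * E B t := by
  rw [E, E, E, ← Matrix.exp_add_of_commute _ _ (((Commute.refl B).smul_left _).smul_right _),
    ← add_smul, neg_add]

theorem E_mul_E_neg (B : Matrix (Fin N) (Fin N) ℝ) (t : ℝ) : E B t * E B (-t) = 1 := by
  rw [← E_add, add_neg_cancel, E_zero]

theorem E_neg_mul_E (B : Matrix (Fin N) (Fin N) ℝ) (t : ℝ) : E B (-t) * E B t = 1 := by
  rw [← E_add, neg_add_cancel, E_zero]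

theorem E_nat_mul (B : Matrix (Fin N) (Fin N) ℝ) (t : ℝ) (k : ℕ) : E B (k * t) = E B t ^ k := by
  rw [E, E, ← Matrix.exp_nsmul, ← Nat.cast_smul_eq_nsmul ℝ, smul_smul, mul_neg]

theorem continuous_E (B : Matrix (Fin N) (Fin N) ℝ) : Continuous (E B) := by
  let _ : NormedRing (Matrix (Fin N) (Fin N) ℝ) := Matrix.linftyOpNormedRing
  let _ : NormedAlgebra ℝ (Matrix (Fin N) (Fin N) ℝ) := Matrix.linftyOpNormedAlgebra
  let _ : NormedAlgebra ℚ (Matrix (Fin N) (Fin N) ℝ) := .restrictScalars ℚ ℝ _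
  exact NormedSpace.exp_continuous.comp (by fun_prop : Continuous fun t : ℝ => -t • B)

theorem map_E (B : Matrix (Fin N) (Fin N) ℝ) (t : ℝ) :
    (E B t).map (algebraMap ℝ ℂ) =
      NormedSpace.exp ((-t : ℂ) • B.map (algebraMap ℝ ℂ)) := by
  let _ : NormedRing (Matrix (Fin N) (Fin N) ℝ) := Matrix.linftyOpNormedRing
  let _ : NormedAlgebra ℝ (Matrix (Fin N) (Fin N) ℝ) := Matrix.linftyOpNormedAlgebra
  let _ : NormedAlgebra ℚ (Matrix (Fin N) (Fin N) ℝ) := .restrictScalars ℚ ℝ _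
  let _ : NormedRing (Matrix (Fin N) (Fin N) ℂ) := Matrix.linftyOpNormedRing
  let _ : NormedAlgebra ℂ (Matrix (Fin N) (Fin N) ℂ) := Matrix.linftyOpNormedAlgebra
  have h := NormedSpace.map_exp (algebraMap ℝ ℂ).mapMatrix
    (continuous_id.matrix_map (continuous_algebraMap ℝ ℂ)) (-t • B)
  rw [RingHom.mapMatrix_apply, RingHom.mapMatrix_apply] at h
  refine h.trans (congrArg _ ?_)
  ext i j
  simp

theorem quadForm_conj (M P : Matrix (Fin N) (Fin N) ℝ) (ξ : Fin N → ℝ) :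
    quadForm (P * M * Pᵀ) ξ = quadForm M (Pᵀ *ᵥ ξ) := by
  rw [quadForm, quadForm, ← Matrix.mulVec_mulVec, ← Matrix.mulVec_mulVec, dotProduct_comm,
    Matrix.dotProduct_mulVec, ← Matrix.mulVec_transpose, dotProduct_comm]

theorem continuous_quadForm_E (A B : Matrix (Fin N) (Fin N) ℝ) (ξ : Fin N → ℝ) :
    Continuous fun s => quadForm (E B s * A * (E B s)ᵀ) ξ := by
  have := continuous_E B
  unfold quadForm
  fun_prop

theorem quadForm_C (A B : Matrix (Fin N) (Fin N) ℝ) (t : ℝ) (ξ : Fin N → ℝ) :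
    quadForm (C A B t) ξ = ∫ s in (0 : ℝ)..t, quadForm (E B s * A * (E B s)ᵀ) ξ := by
  have hE := continuous_E B
  have hc : ∀ i j, Continuous fun s => (E B s * A * (E B s)ᵀ) i j := fun i j =>
    (by fun_prop : Continuous fun s => E B s * A * (E B s)ᵀ).matrix_elem i j
  simp only [quadForm, Matrix.mulVec, dotProduct, C, Matrix.of_apply]
  rw [intervalIntegral.integral_finsetSum fun i _ =>
    ((continuous_finsetSum _ fun j _ => (hc i j).mul_const _).mul_const _).intervalIntegrable _ _]
  refine Finset.sum_congr rfl fun i _ => ?_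
  rw [intervalIntegral.integral_mul_const, intervalIntegral.integral_finsetSum fun j _ =>
    ((hc i j).mul_const _).intervalIntegrable _ _]
  simp only [intervalIntegral.integral_mul_const]

/-- The substitution u = t - s frees the integrand of t, so forms at different times are integrals
of one function. -/
theorem quadForm_E_neg_C (A B : Matrix (Fin N) (Fin N) ℝ) (t : ℝ) (ξ : Fin N → ℝ) :
    quadForm (E B (-t) * C A B t * (E B (-t))ᵀ) ξ =
      ∫ u in (0 : ℝ)..t, quadForm (E B (-u) * A * (E B (-u))ᵀ) ξ := by
  have h : ∀ s, quadForm (E B s * A * (E B s)ᵀ) ((E B (-t))ᵀ *ᵥ ξ) =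
      quadForm (E B (-(t - s)) * A * (E B (-(t - s)))ᵀ) ξ := by
    intro s
    rw [← quadForm_conj, neg_sub, sub_eq_add_neg, add_comm s, E_add, Matrix.transpose_mul]
    simp only [Matrix.mul_assoc]
  rw [quadForm_conj, quadForm_C]
  simp only [h]
  rw [intervalIntegral.integral_comp_sub_left
    (fun u => quadForm (E B (-u) * A * (E B (-u))ᵀ) ξ) t]
  simp

theorem quadForm_transpose_mul_self (S : Matrix (Fin N) (Fin N) ℝ) (ξ : Fin N → ℝ) :
    quadForm (Sᵀ * S) ξ = ∑ i, (S *ᵥ ξ) i ^ 2 := by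
  rw [quadForm, ← Matrix.mulVec_mulVec, dotProduct_comm, Matrix.dotProduct_mulVec,
    ← Matrix.mulVec_transpose, Matrix.transpose_transpose]
  simp [dotProduct, sq]

open scoped MatrixOrder in
theorem exists_eq_transpose_mul_self {A : Matrix (Fin N) (Fin N) ℝ} (hA : A.PosSemidef) :
    ∃ S : Matrix (Fin N) (Fin N) ℝ, A = Sᵀ * S := by
  obtain ⟨S, hS⟩ := CStarAlgebra.nonneg_iff_eq_star_mul_self.mp hA.nonneg
  exact ⟨S, by rwa [Matrix.star_eq_conjTranspose,
    Matrix.conjTranspose_eq_transpose_of_trivial] at hS⟩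

/-! ### Uniform recurrence and the first inequality -/

theorem exists_E_recurrence (B : Matrix (Fin N) (Fin N) ℝ)
    (hB : ∀ z ∈ spectrum ℂ (B.map (algebraMap ℝ ℂ)), z.re = 0) (u h : ℝ) :
    ∃ q : ℕ → ℂ, (∀ k, ‖q k‖ ≤ 2 ^ N) ∧ ∀ i j, (E B u i j : ℂ) =
      ∑ k ∈ Finset.range N, q k * (E B (u - (k + 1) * h) i j : ℂ) := by
  obtain ⟨q, hq, hrec⟩ := exists_bounded_recurrence _ hB (-h)
  -- Multiplying by E(u - Nh) places the k-th power at u - (N-k)h; reversing the index gives u -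
  -- (k+1)h.
  refine ⟨fun k => q (N - 1 - k), fun k => hq _, fun i j => ?_⟩
  have hpow : ∀ k : ℕ, NormedSpace.exp (((-h : ℝ) : ℂ) • B.map (algebraMap ℝ ℂ)) ^ k =
      (E B (k * h)).map (algebraMap ℝ ℂ) := by
    intro k
    rw [E_nat_mul, Matrix.map_pow, map_E, Complex.ofReal_neg]
  simp only [hpow] at hrec
  have hmul := congrArg (fun M => ((E B (u - N * h)).map (algebraMap ℝ ℂ) * M) i j) hrec
  simp only [Finset.mul_sum, mul_smul_comm, ← Matrix.map_mul, ← E_add, Matrix.sum_apply,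
    Matrix.smul_apply, Matrix.map_apply, sub_add_cancel, smul_eq_mul] at hmul
  rw [Complex.coe_algebraMap] at hmul
  rw [← Finset.sum_range_reflect] at hmul
  refine hmul.trans (Finset.sum_congr rfl fun k hk => ?_)
  have hk' := Finset.mem_range.mp hk
  have hcast : ((N - 1 - k : ℕ) : ℝ) = N - 1 - k := by
    rw [Nat.cast_sub (by omega), Nat.cast_sub (by omega), Nat.cast_one]
  rw [hcast, show u - N * h + (N - 1 - k) * h = u - (k + 1) * h by ring]

/-- Each coordinate of S E(u)ᵀ ξ inherits the linear recurrence; squaring the coefficient bound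
gives 4^N and Cauchy–Schwarz gives N. -/
theorem quadForm_E_le_sum {A B : Matrix (Fin N) (Fin N) ℝ} (hA : A.PosSemidef)
    (hB : ∀ z ∈ spectrum ℂ (B.map (algebraMap ℝ ℂ)), z.re = 0) (ξ : Fin N → ℝ) (u h : ℝ) :
    quadForm (E B u * A * (E B u)ᵀ) ξ ≤ (4 ^ N * N) *
      ∑ k ∈ Finset.range N, quadForm (E B (u - (k + 1) * h) * A *
        (E B (u - (k + 1) * h))ᵀ) ξ := by
  obtain ⟨S, hS⟩ := exists_eq_transpose_mul_self hA
  obtain ⟨q, hq, hrec⟩ := exists_E_recurrence B hB u h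
  simp only [quadForm_conj, hS, quadForm_transpose_mul_self]
  rw [Finset.sum_comm, Finset.mul_sum]
  refine Finset.sum_le_sum fun i _ => ?_
  set y : ℝ → ℝ := fun v => (S *ᵥ ((E B v)ᵀ *ᵥ ξ)) i with hy
  change y u ^ 2 ≤ 4 ^ N * N * ∑ k ∈ Finset.range N, y (u - (k + 1) * h) ^ 2
  have hyrec : (y u : ℂ) = ∑ k ∈ Finset.range N, q k * (y (u - (k + 1) * h) : ℂ) := by
    simp only [hy, Matrix.mulVec, dotProduct, Matrix.transpose_apply, Complex.ofReal_sum,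
      Complex.ofReal_mul, hrec, Finset.mul_sum, Finset.sum_mul]
    rw [Finset.sum_comm (s := Finset.range N)]
    refine Finset.sum_congr rfl fun a _ => ?_
    rw [Finset.sum_comm (s := Finset.range N)]
    refine Finset.sum_congr rfl fun b _ => Finset.sum_congr rfl fun k _ => ?_
    ring
  have habs : |y u| ≤ ∑ k ∈ Finset.range N, 2 ^ N * |y (u - (k + 1) * h)| := by
    rw [← Real.norm_eq_abs, ← Complex.norm_real, hyrec]
    refine (norm_sum_le _ _).trans (Finset.sum_le_sum fun k _ => ?_)
    rw [norm_mul, Complex.norm_real, Real.norm_eq_abs]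
    exact mul_le_mul_of_nonneg_right (hq k) (abs_nonneg _)
  rw [← Finset.mul_sum] at habs
  calc y u ^ 2 = |y u| ^ 2 := (sq_abs _).symm
    _ ≤ (2 ^ N * ∑ k ∈ Finset.range N, |y (u - (k + 1) * h)|) ^ 2 := by gcongr
    _ = 4 ^ N * (∑ k ∈ Finset.range N, |y (u - (k + 1) * h)|) ^ 2 := by
      rw [mul_pow, ← pow_mul, mul_comm N 2, pow_mul]; norm_num
    _ ≤ 4 ^ N * (N * ∑ k ∈ Finset.range N, |y (u - (k + 1) * h)| ^ 2) := by
      gcongr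
      simpa using sq_sum_le_card_mul_sum_sq (s := Finset.range N)
        (f := fun k : ℕ => |y (u - (k + 1) * h)|)
    _ = _ := by simp only [sq_abs, mul_assoc]

theorem quadForm_E_nonneg {A : Matrix (Fin N) (Fin N) ℝ} (hA : A.PosSemidef)
    (P : Matrix (Fin N) (Fin N) ℝ) (ξ : Fin N → ℝ) : 0 ≤ quadForm (P * A * Pᵀ) ξ := by
  obtain ⟨S, hS⟩ := exists_eq_transpose_mul_self hA
  rw [quadForm_conj, hS, quadForm_transpose_mul_self]
  positivity

theorem exists_quadForm_le {A B : Matrix (Fin N) (Fin N) ℝ} (hA : A.PosSemidef)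
    (hB : ∀ z ∈ spectrum ℂ (B.map (algebraMap ℝ ℂ)), z.re = 0) :
    ∃ κ : ℝ, 0 < κ ∧ ∀ t μ : ℝ, 0 < t → 0 < μ → μ ≤ 1 → ∀ ξ : Fin N → ℝ,
      quadForm (E B (-(μ * t)) * C A B (μ * t) * (E B (-(μ * t)))ᵀ) ξ ≤
        κ * μ * quadForm (E B (-t) * C A B t * (E B (-t))ᵀ) ξ := by
  set K : ℝ := 2 * (N + 1) * (4 ^ N * N * N) with hK
  -- `K` vanishes when N = 0; adding 1 keeps the constant positive.
  refine ⟨K + 1, by positivity, fun t μ ht hμ hμ1 ξ => ?_⟩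
  rw [quadForm_E_neg_C, quadForm_E_neg_C]
  set g : ℝ → ℝ := fun u => quadForm (E B (-u) * A * (E B (-u))ᵀ) ξ with hg
  have hgc : Continuous g := (continuous_quadForm_E A B ξ).comp continuous_neg
  have hg0 : ∀ u, 0 ≤ g u := fun u => quadForm_E_nonneg hA _ ξ
  have hI : 0 ≤ ∫ s in (0 : ℝ)..t, g s :=
    intervalIntegral.integral_nonneg ht.le fun s _ => hg0 s
  have hbound : ∀ u ∈ Set.Icc 0 (μ * t), g u ≤ K / t * ∫ s in (0 : ℝ)..t, g s := by
    intro u hu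
    have := mul_le_integral_of_recurrence hgc hg0 (N := N) (K := 4 ^ N * N) (by positivity)
      (fun u h => ?_) ht hu.1 (hu.2.trans (mul_le_of_le_one_left ht.le hμ1))
    · rw [div_mul_eq_mul_div, le_div_iff₀ ht, mul_comm]
      exact this
    · refine (quadForm_E_le_sum hA hB ξ (-u) (-h)).trans_eq ?_
      have hk : ∀ k : ℕ, -u - (k + 1) * -h = -(u - (k + 1) * h) := fun k => by ring
      simp only [hk, hg]
  have hmono : ∫ s in (0 : ℝ)..(μ * t), g s ≤
      ∫ _ in (0 : ℝ)..(μ * t), K / t * ∫ s in (0 : ℝ)..t, g s :=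
    intervalIntegral.integral_mono_on (by positivity) (hgc.intervalIntegrable _ _) (by simp)
      hbound
  rw [intervalIntegral.integral_const, smul_eq_mul, sub_zero] at hmono
  calc ∫ s in (0 : ℝ)..(μ * t), g s ≤ μ * t * (K / t * ∫ s in (0 : ℝ)..t, g s) := hmono
    _ = K * μ * ∫ s in (0 : ℝ)..t, g s := by field_simp
    _ ≤ (K + 1) * μ * ∫ s in (0 : ℝ)..t, g s := by gcongr; linarith

/-- Inversion reverses the order of positive definite quadratic forms. -/
theorem quadForm_inv_le {P Q : Matrix (Fin N) (Fin N) ℝ} (hP : P.PosDef) (hQ : Q.PosDef) {c : ℝ}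
    (hc : 0 < c) (h : ∀ ξ, quadForm Q ξ ≤ c * quadForm P ξ) (ξ : Fin N → ℝ) :
    quadForm P⁻¹ ξ ≤ c * quadForm Q⁻¹ ξ := by
  have hPu : IsUnit P.det := (Matrix.isUnit_iff_isUnit_det P).mp hP.isUnit
  have hQu : IsUnit Q.det := (Matrix.isUnit_iff_isUnit_det Q).mp hQ.isUnit
  set η := P⁻¹ *ᵥ ξ with hη
  set ζ := Q⁻¹ *ᵥ ξ with hζ
  have hPη : P *ᵥ η = ξ := by rw [hη, Matrix.mulVec_mulVec, Matrix.mul_nonsing_inv _ hPu]; simp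
  have hQζ : Q *ᵥ ζ = ξ := by rw [hζ, Matrix.mulVec_mulVec, Matrix.mul_nonsing_inv _ hQu]; simp
  have hsymm : (Q *ᵥ η) ⬝ᵥ ζ = η ⬝ᵥ ξ := by
    have hQt : Qᵀ = Q := by
      have := hQ.isHermitian.eq
      rwa [Matrix.conjTranspose_eq_transpose_of_trivial] at this
    rw [dotProduct_comm, Matrix.dotProduct_mulVec, ← Matrix.mulVec_transpose, hQt, hQζ,
      dotProduct_comm]
  have h1 := h η
  -- Completing the square: this expands to c²⟨ζ,ξ⟩ - 2c⟨η,ξ⟩ + ⟨Qη,η⟩, whose last term is at most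
  -- c⟨η,ξ⟩ by `h1`.
  have h2 : 0 ≤ (Q *ᵥ (c • ζ - η)) ⬝ᵥ (c • ζ - η) := by
    have := hQ.posSemidef.dotProduct_mulVec_nonneg (c • ζ - η)
    rwa [star_trivial, dotProduct_comm] at this
  simp only [Matrix.mulVec_sub, Matrix.mulVec_smul, dotProduct_sub, sub_dotProduct,
    smul_dotProduct, dotProduct_smul, hsymm, hQζ, smul_eq_mul] at h2
  simp only [quadForm, hPη] at h1
  simp only [quadForm, ← hη, ← hζ]
  rw [dotProduct_comm ξ ζ, dotProduct_comm ξ η] at h2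
  rw [dotProduct_comm ξ η] at h1
  have h3 : 0 ≤ c * (c * (ζ ⬝ᵥ ξ) - η ⬝ᵥ ξ) := by linarith
  linarith [nonneg_of_mul_nonneg_right h3 hc]

theorem inv_E_neg_mul_mul (B M : Matrix (Fin N) (Fin N) ℝ) (t : ℝ) :
    (E B (-t) * M * (E B (-t))ᵀ)⁻¹ = (E B t)ᵀ * M⁻¹ * E B t := by
  have h : (E B (-t))⁻¹ = E B t := Matrix.inv_eq_right_inv (E_neg_mul_E B t)
  rw [Matrix.mul_inv_rev, Matrix.mul_inv_rev, ← Matrix.transpose_nonsing_inv, h, Matrix.mul_assoc]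

theorem posDef_E_mul_mul (B : Matrix (Fin N) (Fin N) ℝ) {M : Matrix (Fin N) (Fin N) ℝ}
    (hM : M.PosDef) (t : ℝ) : (E B t * M * (E B t)ᵀ).PosDef := by
  rw [← Matrix.conjTranspose_eq_transpose_of_trivial]
  have hu : IsUnit (E B t) :=
    ⟨⟨E B t, E B (-t), E_mul_E_neg B t, E_neg_mul_E B t⟩, rfl⟩
  exact (Matrix.IsUnit.posDef_star_right_conjugate_iff hu).mpr hM

end OrnsteinUhlenbeck

theorem theorem3p4 {N : ℕ} (A B : Matrix (Fin N) (Fin N) ℝ)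
    (hA : A.PosSemidef)
    (hC : ∀ t : ℝ, 0 < t → (OrnsteinUhlenbeck.C A B t).PosDef)
    (hB : ∀ z ∈ spectrum ℂ (B.map (algebraMap ℝ ℂ)), z.re = 0) :
    ∃ k₀ : ℝ, 0 < k₀ ∧
      (∀ t μ : ℝ, 1 ≤ t → 0 < μ → μ ≤ 1 → ∀ ξ : Fin N → ℝ,
        OrnsteinUhlenbeck.quadForm
            (OrnsteinUhlenbeck.E B (-t) * OrnsteinUhlenbeck.C A B t *
              (OrnsteinUhlenbeck.E B (-t))ᵀ) ξ ≥
          k₀ / μ * OrnsteinUhlenbeck.quadForm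
            (OrnsteinUhlenbeck.E B (-(μ * t)) * OrnsteinUhlenbeck.C A B (μ * t) *
              (OrnsteinUhlenbeck.E B (-(μ * t)))ᵀ) ξ) ∧
      (∀ t μ : ℝ, 1 ≤ t → 0 < μ → μ ≤ 1 → ∀ ξ : Fin N → ℝ,
        OrnsteinUhlenbeck.quadForm
            ((OrnsteinUhlenbeck.E B t)ᵀ * (OrnsteinUhlenbeck.C A B t)⁻¹ *
              OrnsteinUhlenbeck.E B t) ξ ≤
          μ / k₀ * OrnsteinUhlenbeck.quadForm
            ((OrnsteinUhlenbeck.E B (μ * t))ᵀ * (OrnsteinUhlenbeck.C A B (μ * t))⁻¹ *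
              OrnsteinUhlenbeck.E B (μ * t)) ξ) := by
  open OrnsteinUhlenbeck in
  obtain ⟨κ, hκ, hle⟩ := exists_quadForm_le hA hB
  refine ⟨κ⁻¹, inv_pos.mpr hκ, fun t μ ht hμ hμ1 ξ => ?_, fun t μ ht hμ hμ1 ξ => ?_⟩
  · have := hle t μ (by linarith) hμ hμ1 ξ
    rw [ge_iff_le, inv_eq_one_div, div_div, one_div_mul_eq_div, div_le_iff₀' (by positivity)]
    exact this
  · rw [div_inv_eq_mul, mul_comm μ κ, ← inv_E_neg_mul_mul, ← inv_E_neg_mul_mul]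
    have ht0 : 0 < t := by linarith
    exact quadForm_inv_le (posDef_E_mul_mul B (hC t ht0) _)
      (posDef_E_mul_mul B (hC (μ * t) (by positivity)) _) (by positivity)
      (hle t μ ht0 hμ hμ1) ξ
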